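/- Let $K=\mathbb{R}$ or $K=\mathbb{C}$, let $n\ge 1$, and let $X=K^n$ with its standard scalar product $\langle x,y\rangle=\sum_i x_i\overline{y_i}$ and Euclidean norm. Let $(T,\rho)$ be a compact metric space with at least two points and $\mathcal{B}$ its Borel $\sigma$-algebra. Let $cabv(K^n)$ be the space of $\sigma$-additive measures $\mu:\mathcal{B}\to K^n$ of finite total variation $\|\mu\|=|\mu|(T)$, and for $0<a<\infty$ put $B_a(K^n)=\{\mu\in cabv(K^n):\|\mu\|\le a\}$. Let $\int f\,d\mu\in K$ denote the integral determined by $\int \varphi_B\,x\,d\mu=\langle x,\mu(B)\rangle$ for $B\in\mathcal{B}$, $x\in K^n$, by linearity in $f$, and by uniform limits. For $f:T\to K^n$ let $\|f\|_\infty=\sup_{t}\|f(t)\|$, and for a map $f$ from $T$ to a metric space let $\|f\|_L\in[0,\infty]$ be its Lipschitz constant. The Monge–Kantorovich norm is $$\|\mu\|_{MK}=\sup\Big\{\Big|\int f\,d\mu\Big| : f:T\to K^n,\ \|f\|_\infty+\|f\|_L\le 1\Big\},\qquad d_{MK}(\mu,\nu)=\|\mu-\nu\|_{MK}.$$ The weak*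 topology on $cabv(K^n)\cong C(T,K^n)'$ is the coarsest topology for which $\mu\mapsto\int f\,d\mu$ is continuous for every continuous $f:T\to K^n$. Let $M\ge 1$, let $\omega_1,\dots,\omega_M:T\to T$ be Lipschitz with Lipschitz constants $r_i=\|\omega_i\|_L$, let $R_1,\dots,R_M:K^n\to K^n$ be linear with operator norms $\|R_i\|$, and for $\mu\in cabv(K^n)$ put $$H(\mu)(B)=\sum_{i=1}^M R_i\big(\mu(\omega_i^{-1}(B))\big)\quad(B\in\mathcal{B}),\qquad d=\sum_{i=1}^M\|R_i\|(1+r_i).$$ Let $0<a<\infty$, $\mu^0\in cabv(K^n)$ and $H_2(\mu)=H(\mu)+\mu^0$. 1. If all $r_i<1$ and $\sum_i\|R_i\|\le\frac12$, then $d<1$. 2. If $\|\mu^0\|+a\sum_i\|R_i\|\le a$, then $B_a(K^n)$ is nonempty, weak*-closed, and $H_2(\mu)\in B_a(K^n)$ for all $\mu\in B_a(K^n)$. 3. Suppose $d<1$, and let $\emptyset\ne A\subseteq B_a(K^n)$ be weak*-closed with $H_2(\mu)\in A$ for all $\mu\in A$. Then $H_2:A\to A$ is a contraction for $d_{MK}$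 with contraction factor at most $d$, that is, $d_{MK}(H_2(\mu),H_2(\nu))\le d\,d_{MK}(\mu,\nu)$ for all $\mu,\nu\in A$. If $\mu^0=0$, then $0\in A$. There exists a unique $\mu^*\in A$ with $H_2(\mu^*)=\mu^*$; if $\mu^0=0$, then $\mu^*=0$. -/

import Mathlib

open MeasureTheory
open scoped ENNReal Topology

namespace FractalVM

section General

variable {S Y : Type*} [MetricSpace S]

/-- The Lipschitz constant `‖f‖_L = sup { ρ(f x, f y) / d(x, y) | x ≠ y }`, with values in
`[0, ∞]`. The function `f` is Lipschitz if and only if it is finite. -/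
noncomputable def lipConst [PseudoMetricSpace Y] (f : S → Y) : ℝ≥0∞ :=
  ⨆ (x : S) (y : S) (_ : x ≠ y), edist (f x) (f y) / edist x y

/-- The bounded Lipschitz norm `‖f‖_BL = ‖f‖_∞ + ‖f‖_L`, with values in `[0, ∞]`. -/
noncomputable def blNorm [SeminormedAddCommGroup Y] (f : S → Y) : ℝ≥0∞ :=
  (⨆ t : S, ‖f t‖ₑ) + lipConst f

/-- The unit ball of the bounded Lipschitz norm. -/
def BL₁ (S Y : Type*) [MetricSpace S] [SeminormedAddCommGroup Y] : Set (S → Y) :=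
  {f | blNorm f ≤ 1}

end General

section Measures

variable (K T X : Type*) [RCLike K] [MetricSpace T] [MeasurableSpace T] [BorelSpace T]
  [NormedAddCommGroup X] [InnerProductSpace K X]

/-- The space of countably additive `X`-valued Borel measures on `T` with bounded variation. -/
noncomputable def cabv : Submodule K (VectorMeasure T X) where
  carrier := {μ | μ.variation Set.univ < ∞}
  zero_mem' := by simp
  add_mem' {μ ν} hμ hν := by
    simp only [Set.mem_ofPred_eq] at hμ hν ⊢
    refine lt_of_le_of_lt (VectorMeasure.variation_add_le (μ := μ) (ν := ν) Set.univ) ?_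
    simpa using ⟨hμ, hν⟩
  smul_mem' c μ hμ := by
    simp only [Set.mem_ofPred_eq] at hμ ⊢
    rw [VectorMeasure.variation_smul]
    simpa [Measure.nnreal_smul_coe_apply] using ENNReal.mul_lt_top (by simp) hμ

variable {K T X}

/-- The variational norm `‖μ‖ = |μ|(T)`. -/
noncomputable def varNorm (μ : cabv K T X) : ℝ :=
  ((μ : VectorMeasure T X).variation Set.univ).toReal

variable (K T X) in
/-- The ball `B_a(X)` of radius `a` of the variational norm. -/
def varBall (a : ℝ) : Set (cabv K T X) := {μ | varNorm μ ≤ a}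

/-- The transported measure followed by `R`: `R ∘ h(μ)`, that is `B ↦ R (μ (h⁻¹ B))`
(for measurable `h`). -/
noncomputable def pushOp (R : X →L[K] X) (h : T → T) (μ : cabv K T X) : cabv K T X :=
  ⟨((μ : VectorMeasure T X).map h).mapRange (R : X →ₗ[K] X).toAddMonoidHom R.continuous, by
    have : IsFiniteMeasure (μ : VectorMeasure T X).variation := ⟨μ.2⟩
    change VectorMeasure.variation _ Set.univ < ∞
    have hle : (((μ : VectorMeasure T X).map h).mapRange
        (R : X →ₗ[K] X).toAddMonoidHom R.continuous).variation ≤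
        ‖R‖₊ • ((μ : VectorMeasure T X).map h).variation := by
      refine VectorMeasure.variation_le_of_forall_enorm_le fun E _ => ?_
      simp only [Measure.smul_apply, Measure.nnreal_smul_coe_apply]
      exact (R.le_opENorm _).trans
        (mul_le_mul_right (VectorMeasure.enorm_measure_le_variation _ E) _)
    exact (hle _).trans_lt (measure_lt_top _ _)⟩

/-- The Markov-type operator `H(μ) = ∑ i, R i ∘ (ω i)(μ)`. -/
noncomputable def markovOp {M : ℕ} (R : Fin M → X →L[K] X) (ω : Fin M → T → T)
    (μ : cabv K T X) : cabv K T X :=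
  ∑ i, pushOp (R i) (ω i) μ

/-- The affine operator `H₂(μ) = H(μ) + μ⁰`. -/
noncomputable def markovOp₂ {M : ℕ} (R : Fin M → X →L[K] X) (ω : Fin M → T → T)
    (μ₀ μ : cabv K T X) : cabv K T X :=
  markovOp R ω μ + μ₀

variable [NormedSpace ℝ X] [IsScalarTower ℝ K X]

variable (K X) in
/-- The scalar product `(x, y) ↦ ⟨x, y⟩`, linear in `x` and antilinear in `y`, as a continuous
real-bilinear map. In Mathlib's convention it is `inner K y x`. -/
noncomputable def pairing : X →L[ℝ] X →L[ℝ] K :=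
  LinearMap.mkContinuous₂
    (LinearMap.mk₂ ℝ (fun x y : X => (inner K y x : K))
      (fun x x' y => inner_add_right y x x')
      (fun c x y => by
        rw [← algebraMap_smul K c x, inner_smul_right, Algebra.smul_def])
      (fun x y y' => inner_add_left y y' x)
      (fun c x y => by
        rw [← algebraMap_smul K c y, inner_smul_left, Algebra.smul_def]
        simp [RCLike.algebraMap_eq_ofReal]))
    1 (fun x y => by
      simpa [mul_comm] using norm_inner_le_norm (𝕜 := K) y x)

/-- The integral `∫ f dμ ∈ K` of an `X`-valued function with respect to an `X`-valued measure,
which extends `∫ (∑ φ_{A_i} x_i) dμ = ∑ ⟨x_i, μ(A_i)⟩`. -/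
noncomputable def vint (f : T → X) (μ : cabv K T X) : K :=
  VectorMeasure.integral (μ : VectorMeasure T X) f (pairing K X)

/-- The Monge-Kantorovich norm `‖μ‖_MK = sup { |∫ f dμ| | f ∈ BL₁ }`. -/
noncomputable def mkNorm (μ : cabv K T X) : ℝ :=
  sSup {r : ℝ | ∃ f ∈ BL₁ T X, r = ‖vint f μ‖}

/-- The Monge-Kantorovich distance. -/
noncomputable def mkDist (μ ν : cabv K T X) : ℝ := mkNorm (μ - ν)

variable (K T X) in
/-- The weak* topology on the space of measures, seen as the dual of `C(T, X)` through
`μ ↦ (f ↦ ∫ f dμ)`: the coarsest topology for which all `μ ↦ ∫ f dμ`, with `f : T → X`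
continuous, are continuous. -/
@[reducible] noncomputable def weakStar : TopologicalSpace (cabv K T X) :=
  TopologicalSpace.induced (fun μ (f : C(T, X)) => vint f μ) Pi.topologicalSpace

end Measures

end FractalVM

/-!
# Fixed points of Markov-type operators on vector measures

The change of variables formula `vint_pushOp` moves `H` to the test functions:
`∫ f dH(μ) = ∑ i, ∫ (R i* ∘ f ∘ ω i) dμ`. A function `f` with `‖f‖_∞ ≤ b` and `‖f‖_L ≤ c` is sent
to functions with bounds `‖R i‖ b` and `‖R i‖ c r i`, and for `b + c ≤ 1` the sum of the two is at
most `‖R i‖ (1 + r i)`. Hence `H₂` is Lipschitz with constant `d` for the Monge–Kantorovich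
distance (`mkDist_markovOp₂_le`). Uniqueness of the fixed point follows because the
Monge–Kantorovich norm is definite: Lipschitz functions are dense in `C(T, X)`
(`exists_lipschitzWith_near`), and the continuous functions determine the variational norm
(`varNorm_le_of_forall_norm_vint_le`). The latter fact also shows that the balls `B_a` are weak*
closed and that `H₂` maps `B_a` into itself.

For existence, completeness of `A` for the Monge–Kantorovich distance is replaced by weak*
compactness of `B_a` (`exists_tendsto_vint_ultrafilter`). By contraction, consecutive iterates of
`H₂` get arbitrarily close in the Monge–Kantorovich norm; being bounded in variation, they have the
same weak* limits along an ultrafilter. As `H₂` is weak* continuous, such a limit is a fixed point,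
and it lies in `A` because `A` is weak* closed (`exists_fixedPoint`).

Weak* compactness needs a Riesz representation theorem for functionals on `C(T, X)`. It is obtained
from the compactness of the bounded sets of positive measures: if `μ i` is bounded in variation, the
measures `|μ i|` have a weak limit `m`, and the limit `Φ` of the functionals `f ↦ ∫ f dμ i`
satisfies `|Φ(f)| ≤ ∫ ‖f‖ dm`. So `Φ` is continuous for the norm of the Hilbert space `L²(m, X)`,
and is represented by a density with respect to `m` (`exists_vint_eq_of_dominated`).
-/

set_option linter.unusedSectionVars false

namespace FractalVM

open MeasureTheory Filter Set
open scoped ENNReal NNReal Topology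

variable {K T X : Type*} [RCLike K] [MetricSpace T] [MeasurableSpace T] [BorelSpace T]
  [NormedAddCommGroup X] [InnerProductSpace K X]

instance (μ : cabv K T X) : IsFiniteMeasure (μ : VectorMeasure T X).variation := ⟨μ.2⟩

/-! ### Integration against a vector measure of bounded variation -/

section Integral

variable [NormedSpace ℝ X] [IsScalarTower ℝ K X]

theorem norm_pairing_le : ‖pairing K X‖ ≤ 1 :=
  LinearMap.mkContinuous₂_norm_le _ zero_le_one _

theorem norm_vint_le (f : T → X) (μ : cabv K T X) :
    ‖vint f μ‖ ≤ ∫ t, ‖f t‖ ∂(μ : VectorMeasure T X).variation :=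
  VectorMeasure.norm_integral_le_integral_norm.trans <|
    mul_le_of_le_one_left (integral_nonneg fun _ => norm_nonneg _) norm_pairing_le

theorem norm_vint_le_of_bound {f : T → X} {b : ℝ} (hb : ∀ t, ‖f t‖ ≤ b) (hb0 : 0 ≤ b)
    (μ : cabv K T X) : ‖vint f μ‖ ≤ b * varNorm μ := by
  refine (VectorMeasure.norm_integral_le_of_norm_le_const (.of_forall hb)).trans ?_
  exact mul_le_mul_of_nonneg_right (mul_le_of_le_one_right hb0 norm_pairing_le)
    ENNReal.toReal_nonneg

theorem vint_smul (c : K) (f : T → X) (μ : cabv K T X) : vint (c • f) μ = c * vint f μ :=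
  setToFun_smul _ (fun c s x => by
    change inner K ((μ : VectorMeasure T X) s) (c • x) = c * inner K ((μ : VectorMeasure T X) s) x
    exact inner_smul_right _ _ _) c f

theorem vint_add {f g : T → X} {μ : cabv K T X}
    (hf : Integrable f (μ : VectorMeasure T X).variation)
    (hg : Integrable g (μ : VectorMeasure T X).variation) :
    vint (f + g) μ = vint f μ + vint g μ :=
  VectorMeasure.integral_add hf hg

theorem vint_sub {f g : T → X} {μ : cabv K T X}
    (hf : Integrable f (μ : VectorMeasure T X).variation)
    (hg : Integrable g (μ : VectorMeasure T X).variation) :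
    vint (f - g) μ = vint f μ - vint g μ :=
  VectorMeasure.integral_sub hf hg

theorem vint_indicator (x : X) {s : Set T} (hs : MeasurableSet s) (μ : cabv K T X) :
    vint (s.indicator fun _ => x) μ = inner K ((μ : VectorMeasure T X) s) x :=
  VectorMeasure.integral_indicator_const x hs

theorem integrable_of_continuous [CompactSpace T] {f : T → X} (hf : Continuous f) (m : Measure T)
    [IsFiniteMeasure m] : Integrable f m :=
  hf.integrable_of_hasCompactSupport (HasCompactSupport.of_compactSpace f)

theorem vint_add_measure [CompactSpace T] {f : T → X} (hf : Continuous f) (μ ν : cabv K T X) :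
    vint f (μ + ν) = vint f μ + vint f ν :=
  VectorMeasure.integral_add_vectorMeasure (integrable_of_continuous hf _)
    (integrable_of_continuous hf _)

theorem vint_sub_measure [CompactSpace T] {f : T → X} (hf : Continuous f) (μ ν : cabv K T X) :
    vint f (μ - ν) = vint f μ - vint f ν :=
  VectorMeasure.integral_sub_vectorMeasure (integrable_of_continuous hf _)
    (integrable_of_continuous hf _)

theorem vint_zero_measure (f : T → X) : vint f (0 : cabv K T X) = 0 :=
  VectorMeasure.integral_zero_vectorMeasure

theorem vint_sum_measure [CompactSpace T] {ι : Type*} {f : T → X} (hf : Continuous f)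
    (s : Finset ι) (μ : ι → cabv K T X) : vint f (∑ i ∈ s, μ i) = ∑ i ∈ s, vint f (μ i) := by
  classical
  induction s using Finset.induction_on with
  | empty => simpa using vint_zero_measure f
  | insert i s his ih => rw [Finset.sum_insert his, Finset.sum_insert his, vint_add_measure hf, ih]

/-- A scalar functional on `X`-valued functions that has the formal properties of an integral
against a finite measure: it is additive on simple functions, and continuous along uniformly
bounded, pointwise convergent sequences of simple functions. -/
structure IsIntegralLike (L : (T → X) → K) : Prop where
  add : ∀ f g : SimpleFunc T X, L (⇑f + ⇑g) = L f + L g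
  tendsto : ∀ (F : ℕ → SimpleFunc T X) (f : T → X) (C : ℝ), (∀ n t, ‖F n t‖ ≤ C) →
    (∀ t, Tendsto (fun n => F n t) atTop (𝓝 (f t))) →
    Tendsto (fun n => L (F n)) atTop (𝓝 (L f))


end Integral

/-! ### Change of variables and measures with densities -/

section Representation

variable [NormedSpace ℝ X] [IsScalarTower ℝ K X]

theorem isIntegralLike_vint (μ : cabv K T X) : IsIntegralLike fun f => vint f μ where
  add f g := vint_add (f.integrable_of_isFiniteMeasure) (g.integrable_of_isFiniteMeasure)
  tendsto F _ C hC hF := VectorMeasure.tendsto_integral_filter_of_norm_le_const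
    (.of_forall fun n => (F n).aestronglyMeasurable) ⟨C, .of_forall fun n => .of_forall (hC n)⟩
    (.of_forall hF)

/-- Two integral-like functionals that agree on the functions `φ_B x` agree on every continuous
function, since such a function is a bounded pointwise limit of simple functions. -/
theorem IsIntegralLike.eq_of_indicator [CompactSpace T] {L L' : (T → X) → K}
    (hL : IsIntegralLike L) (hL' : IsIntegralLike L')
    (h : ∀ (x : X) (s : Set T), MeasurableSet s →
      L (s.indicator fun _ => x) = L' (s.indicator fun _ => x))
    {f : T → X} (hf : Continuous f) : L f = L' f := by
  have hsimple (g : SimpleFunc T X) : L g = L' g := by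
    induction g using SimpleFunc.induction with
    | const x hs =>
      simpa [SimpleFunc.coe_piecewise, Set.piecewise_eq_indicator] using! h x _ hs
    | add _ ih₁ ih₂ => rw [SimpleFunc.coe_add, hL.add, hL'.add, ih₁, ih₂]
  obtain ⟨C, hC⟩ := isCompact_univ.exists_bound_of_continuousOn hf.continuousOn
  have hC' (t : T) : ‖f t‖ ≤ |C| := (hC t trivial).trans (le_abs_self C)
  have hm : StronglyMeasurable f := hf.stronglyMeasurable
  have hlim (t : T) := hm.tendsto_approxBounded_of_norm_le (hC' t)
  have hb (n : ℕ) (t : T) := hm.norm_approxBounded_le (abs_nonneg C) n t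
  refine tendsto_nhds_unique (hL.tendsto _ f _ hb hlim) ?_
  simp_rw [hsimple]
  exact hL'.tendsto _ f _ hb hlim

theorem pushOp_apply (R : X →L[K] X) {h : T → T} (hh : Measurable h) (μ : cabv K T X)
    {s : Set T} (hs : MeasurableSet s) :
    (pushOp R h μ : VectorMeasure T X) s = R ((μ : VectorMeasure T X) (h ⁻¹' s)) :=
  congrArg R (VectorMeasure.map_apply _ hh hs)

/-- The change of variables formula `∫ f d(R ∘ h(μ)) = ∫ (R* ∘ f ∘ h) dμ`. -/
theorem vint_pushOp [CompactSpace T] [CompleteSpace X] (R : X →L[K] X) {h : T → T}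
    (hh : Measurable h) (μ : cabv K T X) {f : T → X} (hf : Continuous f) :
    vint f (pushOp R h μ) = vint (fun t => ContinuousLinearMap.adjoint R (f (h t))) μ := by
  have hL : IsIntegralLike fun f : T → X =>
      vint (fun t => ContinuousLinearMap.adjoint R (f (h t))) μ := by
    have hcomp (g : SimpleFunc T X) : (fun t => ContinuousLinearMap.adjoint R (g (h t))) =
        ((g.comp h hh).map (ContinuousLinearMap.adjoint R)) := rfl
    constructor
    · intro f g
      have hfg : (fun t => ContinuousLinearMap.adjoint R ((⇑f + ⇑g) (h t))) =
          (fun t => ContinuousLinearMap.adjoint R (f (h t))) +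
            fun t => ContinuousLinearMap.adjoint R (g (h t)) := by
        ext1 t
        simp
      rw [hfg, hcomp, hcomp]
      exact vint_add (SimpleFunc.integrable_of_isFiniteMeasure _)
        (SimpleFunc.integrable_of_isFiniteMeasure _)
    · intro F f C hC hF
      refine VectorMeasure.tendsto_integral_filter_of_norm_le_const
        (.of_forall fun n => ?_) ⟨‖ContinuousLinearMap.adjoint R‖ * C,
          .of_forall fun n => .of_forall fun t => ?_⟩ (.of_forall fun t => ?_)
      · rw [hcomp]
        exact SimpleFunc.aestronglyMeasurable _
      · exact ContinuousLinearMap.le_opNorm_of_le _ (hC n _)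
      · exact ((ContinuousLinearMap.adjoint R).continuous.tendsto _).comp (hF (h t))
  refine (isIntegralLike_vint _).eq_of_indicator hL (fun x s hs => ?_) hf
  have hind : (fun t => ContinuousLinearMap.adjoint R ((s.indicator fun _ => x) (h t))) =
      (h ⁻¹' s).indicator fun _ => ContinuousLinearMap.adjoint R x := by
    ext1 t
    by_cases ht : h t ∈ s <;> simp [ht]
  rw [hind, vint_indicator _ hs, vint_indicator _ (hh hs), pushOp_apply R hh μ hs,
    ContinuousLinearMap.adjoint_inner_right]

/-- The measure with density `g` with respect to a positive measure, as an element of `cabv`. -/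
noncomputable def densityMeasure [CompleteSpace X] (m : Measure T) (g : T → X)
    (hg : Integrable g m) : cabv K T X :=
  ⟨m.withDensityᵥ g, by
    change VectorMeasure.variation _ Set.univ < ∞
    rw [Measure.variation_withDensityᵥ hg, withDensity_apply _ MeasurableSet.univ,
      Measure.restrict_univ]
    exact hg.2⟩

theorem vint_densityMeasure [CompactSpace T] [CompleteSpace X] (m : Measure T) {g : T → X}
    (hg : Integrable g m) {f : T → X} (hf : Continuous f) :
    vint f (densityMeasure m g hg : cabv K T X) = ∫ t, inner K (g t) (f t) ∂m := by
  have hmeas {u : T → X} (hu : AEStronglyMeasurable u m) :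
      AEStronglyMeasurable (fun t => inner K (g t) (u t)) m := hg.1.inner hu
  have hL : IsIntegralLike fun f : T → X => ∫ t, inner K (g t) (f t) ∂m := by
    constructor
    · intro f₁ f₂
      have hint (u : SimpleFunc T X) : Integrable (fun t => inner K (g t) (u t)) m := by
        obtain ⟨C, hC⟩ := u.exists_forall_norm_le
        refine (hg.norm.mul_const C).mono' (hmeas u.aestronglyMeasurable) (.of_forall fun t => ?_)
        exact (norm_inner_le_norm _ _).trans (mul_le_mul_of_nonneg_left (hC t) (norm_nonneg _))
      simp only [Pi.add_apply, inner_add_right]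
      exact integral_add (hint f₁) (hint f₂)
    · intro F f C hC hF
      refine tendsto_integral_of_dominated_convergence (fun t => ‖g t‖ * C)
        (fun n => hmeas (F n).aestronglyMeasurable) (hg.norm.mul_const C)
        (fun n => .of_forall fun t => ?_) (.of_forall fun t => ?_)
      · exact (norm_inner_le_norm _ _).trans (mul_le_mul_of_nonneg_left (hC n t) (norm_nonneg _))
      · exact tendsto_const_nhds.inner (hF t)
  refine (isIntegralLike_vint _).eq_of_indicator hL (fun x s hs => ?_) hf
  have hind : (fun t => inner K (g t) ((s.indicator fun _ => x) t)) =
      s.indicator fun t => inner K (g t) x := by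
    ext1 t
    by_cases ht : t ∈ s <;> simp [ht]
  simp only [hind]
  rw [vint_indicator _ hs, integral_indicator hs]
  change inner K (m.withDensityᵥ g s) x = _
  rw [withDensityᵥ_apply hg hs, ← inner_conj_symm, ← integral_inner hg.integrableOn x,
    ← integral_conj]
  simp only [inner_conj_symm]

end Representation

/-! ### The variational norm as a dual norm -/

section Duality

variable [NormedSpace ℝ X] [IsScalarTower ℝ K X]

/-- The radial map of a normed space onto its unit ball moves points away from a point `y` of the
ball by a factor of at most `2`. -/
theorem norm_sub_radial_le {x y : X} (hy : ‖y‖ ≤ 1) :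
    ‖y - (max 1 ‖x‖)⁻¹ • x‖ ≤ 2 * ‖y - x‖ := by
  have hm : (0 : ℝ) < max 1 ‖x‖ := lt_max_of_lt_left one_pos
  have hx : ‖x - (max 1 ‖x‖)⁻¹ • x‖ ≤ ‖y - x‖ := by
    rcases le_total ‖x‖ 1 with h | h
    · simp [max_eq_left h]
    · have hx0 : ‖x‖ ≠ 0 := by linarith
      have : x - (max 1 ‖x‖)⁻¹ • x = (1 - ‖x‖⁻¹) • x := by rw [max_eq_right h, sub_smul, one_smul]
      rw [this, norm_smul, Real.norm_of_nonneg (sub_nonneg.2 (inv_le_one_of_one_le₀ h)), sub_mul,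
        inv_mul_cancel₀ hx0, one_mul]
      have := norm_sub_norm_le x y
      rw [norm_sub_rev] at this
      linarith
  calc ‖y - (max 1 ‖x‖)⁻¹ • x‖ ≤ ‖y - x‖ + ‖x - (max 1 ‖x‖)⁻¹ • x‖ :=
        norm_sub_le_norm_sub_add_norm_sub ..
    _ ≤ 2 * ‖y - x‖ := by linarith

theorem norm_radial_le (x : X) : ‖(max 1 ‖x‖)⁻¹ • x‖ ≤ 1 := by
  have hm : (0 : ℝ) < max 1 ‖x‖ := lt_max_of_lt_left one_pos
  rw [norm_smul, norm_inv, Real.norm_of_nonneg hm.le, inv_mul_le_one₀ hm]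
  exact le_max_right _ _

/-- The variation of `μ` is attained, up to a small error, as `|∫ s dμ|` for a simple function `s`
with values in the unit ball, which is `μ(p) / ‖μ(p)‖` on the pieces `p` of a partition. -/
theorem exists_lt_norm_vint_of_lt_varNorm {μ : cabv K T X} {a : ℝ} (ha : 0 ≤ a)
    (h : a < varNorm μ) :
    ∃ s : T → X, Integrable s (μ : VectorMeasure T X).variation ∧ (∀ t, ‖s t‖ ≤ 1) ∧
      a < ‖vint s μ‖ := by
  classical
  set m : VectorMeasure T X := (μ : VectorMeasure T X) with hm
  have h' : ENNReal.ofReal a < m.variation univ :=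
    (ENNReal.ofReal_lt_iff_lt_toReal ha μ.2.ne).2 h
  obtain ⟨P, -, hdisj, hmeas, hP⟩ := m.exists_lt_sum_of_lt_variation MeasurableSet.univ h'
  let u : Set T → X := fun p => ((‖m p‖⁻¹ : ℝ) : K) • m p
  have hu (p : Set T) : ‖u p‖ ≤ 1 := by
    simp only [u, norm_smul, RCLike.norm_ofReal, abs_inv, abs_norm]
    exact inv_mul_le_one
  have hint (p : Set T) (hp : p ∈ P) : Integrable (p.indicator fun _ => u p) m.variation :=
    (integrable_const _).indicator (hmeas p hp)
  refine ⟨fun t => ∑ p ∈ P, p.indicator (fun _ => u p) t, integrable_finsetSum _ hint,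
    fun t => ?_, ?_⟩
  · beta_reduce
    by_cases ht : ∃ p ∈ P, t ∈ p
    · obtain ⟨p, hp, htp⟩ := ht
      rw [Finset.sum_eq_single_of_mem p hp fun q hq hqp => ?_]
      · simpa [htp] using hu p
      · exact indicator_of_notMem
          (fun htq => Set.disjoint_left.1 (hdisj hq hp hqp) htq htp) _
    · rw [Finset.sum_eq_zero fun p hp => ?_]
      · simp
      · exact indicator_of_notMem (fun htp => ht ⟨p, hp, htp⟩) _
  · have hval : vint (fun t => ∑ p ∈ P, p.indicator (fun _ => u p) t) μ =
        ((∑ p ∈ P, ‖m p‖ : ℝ) : K) := by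
      rw [vint, VectorMeasure.integral_finsetSum P hint, RCLike.ofReal_sum]
      refine Finset.sum_congr rfl fun p hp => (vint_indicator _ (hmeas p hp) μ).trans ?_
      simp only [u, ← hm, inner_smul_right, inner_self_eq_norm_sq_to_K]
      rcases eq_or_ne ‖m p‖ 0 with h0 | h0
      · simp [h0]
      · rw [← RCLike.ofReal_pow, ← RCLike.ofReal_mul, pow_two, inv_mul_cancel_left₀ h0]
    rw [hval, RCLike.norm_ofReal, abs_of_nonneg (Finset.sum_nonneg fun _ _ => norm_nonneg _)]
    have : ∑ p ∈ P, ‖m p‖ₑ = ENNReal.ofReal (∑ p ∈ P, ‖m p‖) := by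
      rw [ENNReal.ofReal_sum_of_nonneg fun _ _ => norm_nonneg _]
      simp
    rw [this] at hP
    exact (ENNReal.ofReal_lt_ofReal_iff_of_nonneg ha).1 hP

/-- The variational norm is the norm of the functional `f ↦ ∫ f dμ` on `C(T, X)`: an upper bound
for the latter is one for the former. -/
theorem varNorm_le_of_forall_norm_vint_le [CompactSpace T] {μ : cabv K T X} {a : ℝ} (ha : 0 ≤ a)
    (h : ∀ f : C(T, X), (∀ t, ‖f t‖ ≤ 1) → ‖vint f μ‖ ≤ a) : varNorm μ ≤ a := by
  by_contra! hlt
  obtain ⟨s, hs, hs1, has⟩ := exists_lt_norm_vint_of_lt_varNorm ha hlt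
  have hε : 0 < (‖vint s μ‖ - a) / 4 := by linarith
  obtain ⟨g, hg, hgint⟩ := hs.exists_boundedContinuous_integral_sub_le hε
  -- Retracting the `L¹` approximation `g` of `s` radially makes it admissible in `h`.
  have hcont : Continuous fun t => (max 1 ‖g t‖)⁻¹ • g t := by
    refine ((continuous_const.max g.continuous.norm).inv₀ fun t => ?_).smul g.continuous
    exact (lt_max_of_lt_left one_pos).ne'
  let r : C(T, X) := ⟨_, hcont⟩
  have hr : ‖vint r μ‖ ≤ a := h r fun t => norm_radial_le _
  have hrint : Integrable r (μ : VectorMeasure T X).variation :=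
    Integrable.of_bound hcont.aestronglyMeasurable 1 (.of_forall fun t => norm_radial_le _)
  have hdiff : ‖vint s μ - vint r μ‖ ≤ 2 * ((‖vint s μ‖ - a) / 4) := by
    rw [← vint_sub hs hrint]
    refine (norm_vint_le _ _).trans ?_
    calc ∫ t, ‖(s - ⇑r) t‖ ∂(μ : VectorMeasure T X).variation
        ≤ ∫ t, 2 * ‖s t - g t‖ ∂(μ : VectorMeasure T X).variation :=
          integral_mono (hs.sub hrint).norm ((hs.sub hgint).norm.const_mul 2)
            fun t => norm_sub_radial_le (hs1 t)
      _ ≤ 2 * ((‖vint s μ‖ - a) / 4) := by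
          rw [integral_const_mul]
          gcongr
  have := norm_sub_norm_le (vint s μ) (vint r μ)
  linarith

theorem varNorm_eq_zero_iff {μ : cabv K T X} : varNorm μ = 0 ↔ μ = 0 := by
  rw [varNorm, ENNReal.toReal_eq_zero_iff, or_iff_left μ.2.ne, Measure.measure_univ_eq_zero,
    VectorMeasure.variation_eq_zero, ZeroMemClass.coe_eq_zero]

theorem eq_zero_of_forall_vint_eq_zero [CompactSpace T] {μ : cabv K T X}
    (h : ∀ f : C(T, X), vint f μ = 0) :
    μ = 0 :=
  varNorm_eq_zero_iff.1 <| le_antisymm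
    (varNorm_le_of_forall_norm_vint_le le_rfl fun f _ => by simp [h f]) ENNReal.toReal_nonneg

theorem continuous_vint (f : C(T, X)) :
    Continuous[weakStar K T X, inferInstance] fun μ : cabv K T X => vint f μ := by
  let _ := weakStar K T X
  have h : Continuous fun (μ : cabv K T X) (f : C(T, X)) => vint f μ := continuous_induced_dom
  exact continuous_pi_iff.1 h f

/-- A family converges in the weak* topology if its integrals of continuous functions do. -/
theorem tendsto_weakStar {ι : Type*} {l : Filter ι} {μ : ι → cabv K T X} {ν : cabv K T X}
    (h : ∀ f : C(T, X), Tendsto (fun i => vint f (μ i)) l (𝓝 (vint f ν))) :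
    Tendsto μ l (@nhds _ (weakStar K T X) ν) := by
  let _ := weakStar K T X
  rw [nhds_induced, tendsto_comap_iff]
  exact tendsto_pi_nhds.2 h

theorem isClosed_varBall [CompactSpace T] {a : ℝ} (ha : 0 ≤ a) :
    IsClosed[weakStar K T X] (varBall K T X a) := by
  let _ := weakStar K T X
  have : varBall K T X a =
      ⋂ (f : C(T, X)) (_ : ∀ t, ‖f t‖ ≤ 1), {μ | ‖vint f μ‖ ≤ a} := by
    ext μ
    simp only [mem_iInter, mem_ofPred_eq]
    refine ⟨fun hμ f hf => ?_, varNorm_le_of_forall_norm_vint_le ha⟩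
    exact (norm_vint_le_of_bound hf zero_le_one μ).trans ((one_mul _).trans_le hμ)
  rw [this]
  exact isClosed_iInter fun f => isClosed_iInter fun _ =>
    isClosed_le (continuous_vint f).norm continuous_const

end Duality

/-! ### Density of the Lipschitz functions -/

section LipschitzApproximation

/-- The algebra of real-valued Lipschitz functions on a compact metric space. -/
def lipschitzSubalgebra (T : Type*) [MetricSpace T] [CompactSpace T] : Subalgebra ℝ C(T, ℝ) where
  carrier := {f | ∃ C : ℝ≥0, LipschitzWith C f}
  mul_mem' := by
    rintro f g ⟨C, hC⟩ ⟨D, hD⟩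
    refine ⟨‖f‖₊ * D + ‖g‖₊ * C, LipschitzWith.of_dist_le_mul fun x y => ?_⟩
    have h : (f * g) x - (f * g) y = f x * (g x - g y) + g y * (f x - f y) := by
      simp only [ContinuousMap.mul_apply]
      ring
    have h₁ := hC.dist_le_mul x y
    have h₂ := hD.dist_le_mul x y
    rw [Real.dist_eq] at h₁ h₂ ⊢
    rw [h]
    refine (abs_add_le _ _).trans ?_
    rw [abs_mul, abs_mul]
    push_cast
    rw [add_mul, mul_assoc, mul_assoc]
    exact add_le_add (mul_le_mul (f.norm_coe_le_norm x) h₂ (abs_nonneg _) (norm_nonneg _))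
      (mul_le_mul (g.norm_coe_le_norm y) h₁ (abs_nonneg _) (norm_nonneg _))
  add_mem' := by
    rintro f g ⟨C, hC⟩ ⟨D, hD⟩
    exact ⟨C + D, hC.add hD⟩
  algebraMap_mem' r := ⟨0, LipschitzWith.const r⟩

theorem lipschitzSubalgebra_separatesPoints (T : Type*) [MetricSpace T] [CompactSpace T] :
    (lipschitzSubalgebra T).SeparatesPoints := by
  intro x y hxy
  refine ⟨fun t => dist t y, ⟨⟨_, continuous_id.dist continuous_const⟩, ?_, rfl⟩, ?_⟩
  · exact ⟨1, LipschitzWith.dist_left y⟩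
  · simpa using hxy

/-- Lipschitz functions with values in a finite-dimensional space are uniformly dense in the
continuous functions, by the Stone–Weierstrass theorem applied to the coordinates. -/
theorem exists_lipschitzWith_near {E : Type*} [NormedAddCommGroup E] [NormedSpace ℝ E]
    [FiniteDimensional ℝ E] [CompactSpace T] (f : C(T, E)) {ε : ℝ} (hε : 0 < ε) :
    ∃ (g : T → E) (C : ℝ≥0), LipschitzWith C g ∧ ∀ t, ‖g t - f t‖ ≤ ε := by
  let b := Module.finBasis ℝ E
  let S : ℝ := ∑ i, ‖b i‖
  have hS : 0 ≤ S := Finset.sum_nonneg fun _ _ => norm_nonneg _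
  have hδ : 0 < ε / (S + 1) := by positivity
  have hcoord (i) : Continuous fun t => b.coord i (f t) :=
    ((b.coord i).continuous_of_finiteDimensional).comp f.continuous
  choose g hg using fun i =>
    ContinuousMap.exists_mem_subalgebra_near_continuous_of_separatesPoints _
      (lipschitzSubalgebra_separatesPoints T) _ (hcoord i) _ hδ
  choose C hC using fun i => (g i).2
  refine ⟨fun t => ∑ i, (g i : C(T, ℝ)) t • b i, ∑ i, C i * ‖b i‖₊,
    LipschitzWith.of_dist_le_mul fun x y => ?_, fun t => ?_⟩
  · rw [dist_eq_norm, ← Finset.sum_sub_distrib, NNReal.coe_sum, Finset.sum_mul]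
    refine norm_sum_le_of_le _ fun i _ => ?_
    rw [← sub_smul, norm_smul, NNReal.coe_mul, mul_right_comm, coe_nnnorm]
    gcongr
    exact (hC i).dist_le_mul x y
  · have hf : f t = ∑ i, b.coord i (f t) • b i := by simp [b.sum_repr]
    calc ‖∑ i, (g i : C(T, ℝ)) t • b i - f t‖
        = ‖∑ i, ((g i : C(T, ℝ)) t - b.coord i (f t)) • b i‖ := by
          simp_rw [sub_smul]
          rw [Finset.sum_sub_distrib, ← hf]
      _ ≤ ∑ i, ε / (S + 1) * ‖b i‖ := norm_sum_le_of_le _ fun i _ => by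
          rw [norm_smul]
          gcongr
          exact (hg i t).le
      _ = ε / (S + 1) * S := (Finset.mul_sum ..).symm
      _ ≤ ε := by
          rw [div_mul_eq_mul_div, div_le_iff₀ (by positivity)]
          nlinarith

end LipschitzApproximation

/-! ### The unit ball of the bounded Lipschitz norm -/

section BoundedLipschitz

theorem lipschitzWith_iff_lipConst_le {Y : Type*} [PseudoMetricSpace Y] {f : T → Y} {C : ℝ≥0} :
    LipschitzWith C f ↔ lipConst f ≤ C := by
  simp only [lipConst, iSup_le_iff]
  refine forall₂_congr fun x y => ?_
  rcases eq_or_ne x y with rfl | hxy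
  · simp
  · simp [hxy, ENNReal.div_le_iff (edist_pos.2 hxy).ne' (edist_ne_top x y)]

theorem mem_BL₁_iff {Y : Type*} [SeminormedAddCommGroup Y] {f : T → Y} :
    f ∈ BL₁ T Y ↔ ∃ b c : ℝ≥0, b + c ≤ 1 ∧ (∀ t, ‖f t‖ ≤ b) ∧ LipschitzWith c f := by
  constructor
  · intro hf
    have hf' : (⨆ t : T, ‖f t‖ₑ) + lipConst f ≤ 1 := hf
    have hb : (⨆ t : T, ‖f t‖ₑ) ≠ ∞ := (le_self_add.trans hf').trans_lt ENNReal.one_lt_top |>.ne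
    have hc : lipConst f ≠ ∞ := (le_add_self.trans hf').trans_lt ENNReal.one_lt_top |>.ne
    refine ⟨(⨆ t : T, ‖f t‖ₑ).toNNReal, (lipConst f).toNNReal, ?_, fun t => ?_, ?_⟩
    · rw [← ENNReal.coe_le_coe]
      push_cast
      rwa [ENNReal.coe_toNNReal hb, ENNReal.coe_toNNReal hc]
    · rw [← coe_nnnorm, NNReal.coe_le_coe, ← ENNReal.coe_le_coe, ENNReal.coe_toNNReal hb]
      exact le_iSup (fun t => ‖f t‖ₑ) t
    · rw [lipschitzWith_iff_lipConst_le, ENNReal.coe_toNNReal hc]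
  · rintro ⟨b, c, hbc, hb, hc⟩
    have h₁ : (⨆ t : T, ‖f t‖ₑ) ≤ b := iSup_le fun t => by
      rw [enorm_eq_nnnorm, ENNReal.coe_le_coe]
      exact hb t
    calc blNorm f ≤ b + c := add_le_add h₁ (lipschitzWith_iff_lipConst_le.1 hc)
      _ ≤ 1 := by exact_mod_cast hbc

end BoundedLipschitz

/-! ### The Monge–Kantorovich norm -/

section MongeKantorovich

variable [NormedSpace ℝ X] [IsScalarTower ℝ K X]

theorem norm_vint_le_mkNorm {f : T → X} (hf : f ∈ BL₁ T X) (μ : cabv K T X) :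
    ‖vint f μ‖ ≤ mkNorm μ := by
  refine le_csSup ⟨varNorm μ, ?_⟩ ⟨f, hf, rfl⟩
  rintro _ ⟨g, hg, rfl⟩
  obtain ⟨b, c, hbc, hb, -⟩ := mem_BL₁_iff.1 hg
  have hb1 (t : T) : ‖g t‖ ≤ 1 :=
    (hb t).trans (NNReal.coe_le_one.2 (le_self_add.trans hbc))
  simpa using norm_vint_le_of_bound hb1 zero_le_one μ

theorem mkNorm_nonneg (μ : cabv K T X) : 0 ≤ mkNorm μ :=
  Real.sSup_nonneg <| by
    rintro _ ⟨f, -, rfl⟩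
    exact norm_nonneg _

theorem mkNorm_le {μ : cabv K T X} {r : ℝ} (h : ∀ f ∈ BL₁ T X, ‖vint f μ‖ ≤ r) (hr : 0 ≤ r) :
    mkNorm μ ≤ r :=
  Real.sSup_le (by rintro _ ⟨f, hf, rfl⟩; exact h f hf) hr

/-- Homogeneous form of `norm_vint_le_mkNorm`, obtained by rescaling `f` into `BL₁`. -/
theorem norm_vint_le_mul_mkNorm {f : T → X} {b c : ℝ≥0} (hb : ∀ t, ‖f t‖ ≤ b)
    (hc : LipschitzWith c f) (μ : cabv K T X) : ‖vint f μ‖ ≤ (b + c) * mkNorm μ := by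
  rcases eq_or_ne (b + c) 0 with h0 | h0
  · obtain ⟨rfl, rfl⟩ := add_eq_zero.1 h0
    simpa using norm_vint_le_of_bound hb le_rfl μ
  · obtain ⟨k, hk⟩ : ∃ k : K, ‖k‖₊ = (b + c)⁻¹ :=
      ⟨(((b + c)⁻¹ : ℝ≥0) : ℝ), NNReal.eq (RCLike.norm_of_nonneg (NNReal.coe_nonneg _))⟩
    have hmem : k • f ∈ BL₁ T X := by
      refine mem_BL₁_iff.2 ⟨(b + c)⁻¹ * b, (b + c)⁻¹ * c, ?_, fun t => ?_, ?_⟩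
      · rw [← mul_add, inv_mul_cancel₀ h0]
      · rw [Pi.smul_apply, norm_smul, ← coe_nnnorm, hk, NNReal.coe_mul]
        gcongr
        exact hb t
      · rw [← hk]
        exact (lipschitzWith_smul k).comp hc
    have h := norm_vint_le_mkNorm hmem μ
    rw [vint_smul, norm_mul, ← coe_nnnorm, hk, NNReal.coe_inv, inv_mul_le_iff₀ (by
      exact_mod_cast pos_iff_ne_zero.2 h0)] at h
    exact_mod_cast h

/-- On sets of bounded variation, convergence to `0` in the Monge–Kantorovich norm implies weak*
convergence to `0`, because the Lipschitz functions are dense in `C(T, X)`. -/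
theorem tendsto_vint_zero_of_tendsto_mkNorm [CompactSpace T] [FiniteDimensional ℝ X]
    {ι : Type*} {l : Filter ι} {ν : ι → cabv K T X} {b : ℝ}
    (hb : ∀ i, varNorm (ν i) ≤ b) (hν : Tendsto (fun i => mkNorm (ν i)) l (𝓝 0)) (f : C(T, X)) :
    Tendsto (fun i => vint f (ν i)) l (𝓝 0) := by
  rw [Metric.tendsto_nhds]
  intro ε hε
  have hδ : 0 < ε / (2 * (|b| + 1)) := by positivity
  obtain ⟨g, C, hg, hgf⟩ := exists_lipschitzWith_near f hδ
  obtain ⟨D, hD⟩ := isCompact_univ.exists_bound_of_continuousOn hg.continuous.continuousOn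
  have hD' (t : T) : ‖g t‖ ≤ |D|.toNNReal := by
    rw [Real.coe_toNNReal _ (abs_nonneg D)]
    exact (hD t trivial).trans (le_abs_self D)
  have hlim : Tendsto (fun i => (|D|.toNNReal + C) * mkNorm (ν i)) l (𝓝 0) := by
    simpa using hν.const_mul ((|D|.toNNReal : ℝ) + C)
  filter_upwards [(tendsto_order.1 hlim).2 (ε / 2) (half_pos hε)] with i hi
  have h₁ : ‖vint g (ν i)‖ < ε / 2 := (norm_vint_le_mul_mkNorm hD' hg _).trans_lt hi
  have h₂ : ‖vint g (ν i) - vint f (ν i)‖ ≤ ε / 2 := by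
    rw [← vint_sub (integrable_of_continuous hg.continuous _)
      (integrable_of_continuous f.continuous _)]
    refine (norm_vint_le_of_bound (b := ε / (2 * (|b| + 1))) hgf hδ.le _).trans ?_
    calc ε / (2 * (|b| + 1)) * varNorm (ν i) ≤ ε / (2 * (|b| + 1)) * (|b| + 1) := by
          gcongr
          linarith [hb i, le_abs_self b]
      _ = ε / 2 := by field_simp
  rw [dist_zero_right]
  have := norm_sub_norm_le (vint f (ν i)) (vint g (ν i))
  rw [norm_sub_rev] at this
  linarith

/-- The Monge–Kantorovich norm is definite. -/
theorem eq_zero_of_mkNorm_eq_zero [CompactSpace T] [FiniteDimensional ℝ X] {μ : cabv K T X}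
    (h : mkNorm μ = 0) : μ = 0 :=
  eq_zero_of_forall_vint_eq_zero fun f =>
    tendsto_nhds_unique (l := (atTop : Filter ℕ)) tendsto_const_nhds
      (tendsto_vint_zero_of_tendsto_mkNorm (fun _ => le_rfl) (by simp [h]) f)

end MongeKantorovich

/-! ### Markov-type operators -/

section MarkovOperator

variable [NormedSpace ℝ X] [IsScalarTower ℝ K X] [CompactSpace T] [CompleteSpace X]
  {M : ℕ} {ω : Fin M → T → T} {R : Fin M → X →L[K] X}

theorem vint_markovOp (hω : ∀ i, Continuous (ω i)) {f : T → X} (hf : Continuous f)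
    (μ : cabv K T X) : vint f (markovOp R ω μ) =
      ∑ i, vint (fun t => ContinuousLinearMap.adjoint (R i) (f (ω i t))) μ := by
  rw [markovOp, vint_sum_measure hf]
  exact Finset.sum_congr rfl fun i _ => vint_pushOp (R i) (hω i).measurable μ hf

theorem markovOp_sub (hω : ∀ i, Continuous (ω i)) (μ ν : cabv K T X) :
    markovOp R ω (μ - ν) = markovOp R ω μ - markovOp R ω ν := by
  refine sub_eq_zero.1 (eq_zero_of_forall_vint_eq_zero fun f => ?_)
  rw [vint_sub_measure f.continuous, vint_sub_measure f.continuous, vint_markovOp hω f.continuous,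
    vint_markovOp hω f.continuous, vint_markovOp hω f.continuous, ← Finset.sum_sub_distrib,
    sub_eq_zero]
  exact Finset.sum_congr rfl fun i _ => vint_sub_measure
    ((ContinuousLinearMap.continuous _).comp (f.continuous.comp (hω i))) _ _

theorem markovOp_zero (hω : ∀ i, Continuous (ω i)) : markovOp R ω (0 : cabv K T X) = 0 := by
  simpa using markovOp_sub (R := R) hω (0 : cabv K T X) 0

theorem varNorm_markovOp₂_le (hω : ∀ i, Continuous (ω i)) (μ₀ μ : cabv K T X) :
    varNorm (markovOp₂ R ω μ₀ μ) ≤ (∑ i, ‖R i‖) * varNorm μ + varNorm μ₀ := by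
  have hpos (ν : cabv K T X) : 0 ≤ varNorm ν := ENNReal.toReal_nonneg
  refine varNorm_le_of_forall_norm_vint_le (add_nonneg (mul_nonneg (Finset.sum_nonneg
    fun _ _ => norm_nonneg _) (hpos μ)) (hpos μ₀)) fun f hf => ?_
  rw [markovOp₂, vint_add_measure f.continuous, vint_markovOp hω f.continuous, Finset.sum_mul]
  refine norm_add_le_of_le (norm_sum_le_of_le _ fun i _ => ?_) ?_
  · refine norm_vint_le_of_bound (fun t => ?_) (norm_nonneg _) μ
    rw [← ContinuousLinearMap.adjoint.norm_map (R i)]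
    exact ContinuousLinearMap.unit_le_opNorm _ _ (hf _)
  · simpa using norm_vint_le_of_bound hf zero_le_one μ₀

/-- If `b + c ≤ 1`, `‖f‖_∞ ≤ b` and `‖f‖_L ≤ c`, then `R i* ∘ f ∘ ω i` has supremum norm at most
`‖R i‖ b` and Lipschitz constant at most `‖R i‖ c r i`, where `b + c r i ≤ 1 + r i`. -/
theorem mkNorm_markovOp_le {r : Fin M → ℝ≥0} (hω : ∀ i, LipschitzWith (r i) (ω i))
    (μ : cabv K T X) : mkNorm (markovOp R ω μ) ≤ (∑ i, ‖R i‖ * (1 + r i)) * mkNorm μ := by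
  have hpos := mkNorm_nonneg μ
  refine mkNorm_le (fun f hf => ?_) (by positivity)
  obtain ⟨b, c, hbc, hb, hc⟩ := mem_BL₁_iff.1 hf
  rw [vint_markovOp (fun i => (hω i).continuous) hc.continuous, Finset.sum_mul]
  refine norm_sum_le_of_le _ fun i _ => ?_
  have hR : ‖ContinuousLinearMap.adjoint (R i)‖₊ = ‖R i‖₊ := by
    ext
    exact ContinuousLinearMap.adjoint.norm_map (R i)
  have hbound (t : T) :
      ‖ContinuousLinearMap.adjoint (R i) (f (ω i t))‖ ≤ (‖R i‖₊ * b : ℝ≥0) := by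
    rw [← hR]
    exact ContinuousLinearMap.le_opNorm_of_le _ (hb _)
  have hlip : LipschitzWith (‖R i‖₊ * (c * r i))
      fun t => ContinuousLinearMap.adjoint (R i) (f (ω i t)) :=
    hR ▸ (ContinuousLinearMap.lipschitz _).comp (hc.comp (hω i))
  refine (norm_vint_le_mul_mkNorm hbound hlip μ).trans (mul_le_mul_of_nonneg_right ?_ hpos)
  have hb1 : (b : ℝ) ≤ 1 := by exact_mod_cast le_self_add.trans hbc
  have hc1 : (c : ℝ) ≤ 1 := by exact_mod_cast le_add_self.trans hbc
  push_cast
  rw [← mul_add]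
  gcongr
  exact mul_le_of_le_one_left (r i).2 hc1

theorem mkDist_markovOp₂_le {r : Fin M → ℝ≥0} (hω : ∀ i, LipschitzWith (r i) (ω i))
    (μ₀ μ ν : cabv K T X) : mkDist (markovOp₂ R ω μ₀ μ) (markovOp₂ R ω μ₀ ν) ≤
      (∑ i, ‖R i‖ * (1 + r i)) * mkDist μ ν := by
  rw [mkDist, markovOp₂, markovOp₂, add_sub_add_right_eq_sub,
    ← markovOp_sub fun i => (hω i).continuous]
  exact mkNorm_markovOp_le hω _

end MarkovOperator

/-! ### Weak* compactness -/

section WeakStarCompactness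

variable [NormedSpace ℝ X] [IsScalarTower ℝ K X] [CompactSpace T] [CompleteSpace X]

theorem integral_norm_le_mul_norm_toLp (m : Measure T) [IsFiniteMeasure m] (f : C(T, X)) :
    ∫ t, ‖f t‖ ∂m ≤
      (m univ ^ (1 / (2 : ℝ))).toReal * ‖ContinuousMap.toLp 2 m K f‖ := by
  have hf : AEStronglyMeasurable f m := f.continuous.aestronglyMeasurable
  have h := eLpNorm_le_eLpNorm_mul_rpow_measure_univ (p := 1) (q := 2) one_le_two hf
  rw [integral_norm_eq_lintegral_enorm hf, ← eLpNorm_one_eq_lintegral_enorm, mul_comm,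
    Lp.norm_def, eLpNorm_congr_ae (ContinuousMap.coeFn_toLp m f), ← ENNReal.toReal_mul]
  refine ENNReal.toReal_mono (ENNReal.mul_ne_top ?_ ?_) (h.trans_eq ?_)
  · exact (memLp_congr_ae (ContinuousMap.coeFn_toLp (𝕜 := K) m f)).1
      (Lp.memLp _) |>.eLpNorm_ne_top
  · exact ENNReal.rpow_ne_top_of_nonneg (by norm_num) (measure_ne_top _ _)
  · norm_num

/-- **Riesz representation.** A functional on `C(T, X)` dominated by `f ↦ ∫ ‖f‖ dm` for a finite
measure `m` is integration against an `X`-valued measure: it extends to `L²(m, X)`, hence is given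
by an `L²` density with respect to `m`. -/
theorem exists_vint_eq_of_dominated (m : Measure T) [IsFiniteMeasure m] (Φ : C(T, X) →ₗ[K] K)
    (hΦ : ∀ f, ‖Φ f‖ ≤ ∫ t, ‖f t‖ ∂m) : ∃ ν : cabv K T X, ∀ f : C(T, X), vint f ν = Φ f := by
  let e : C(T, X) →ₗ[K] Lp X 2 m := (ContinuousMap.toLp 2 m K).toLinearMap
  have he : DenseRange e := ContinuousMap.toLp_denseRange X m K (by norm_num)
  have hbound : ∃ C, ∀ f, ‖Φ f‖ ≤ C * ‖e f‖ :=
    ⟨_, fun f => (hΦ f).trans (integral_norm_le_mul_norm_toLp m f)⟩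
  let g : Lp X 2 m := (InnerProductSpace.toDual K (Lp X 2 m)).symm (Φ.extendOfNorm e)
  have hg : Integrable g m := (Lp.memLp g).integrable one_le_two
  refine ⟨densityMeasure m g hg, fun f => ?_⟩
  have h : inner K g (e f) = Φ f := by
    rw [InnerProductSpace.toDual_symm_apply, LinearMap.extendOfNorm_eq he hbound]
  rw [vint_densityMeasure m hg f.continuous, ← h, L2.inner_def]
  refine integral_congr_ae ?_
  filter_upwards [ContinuousMap.coeFn_toLp (p := 2) (𝕜 := K) m f] with t ht
  exact congrArg _ ht.symm

/-- The balls of `cabv` are weak* compact, in terms of ultrafilters. The functionals `f ↦ ∫ f dμ i`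
converge pointwise by compactness of the balls of `K`; their limit is dominated by a weak limit of
the variation measures, so that it is represented by a measure. -/
theorem exists_tendsto_vint_ultrafilter {ι : Type*} (l : Ultrafilter ι) {μ : ι → cabv K T X}
    {a : ℝ} (hμ : ∀ i, varNorm (μ i) ≤ a) :
    ∃ ν : cabv K T X, ∀ f : C(T, X), Tendsto (fun i => vint f (μ i)) l (𝓝 (vint f ν)) := by
  let V (i : ι) : FiniteMeasure T := ⟨(μ i : VectorMeasure T X).variation, inferInstance⟩
  have hV (i : ι) : (V i).mass ≤ a.toNNReal :=
    NNReal.coe_le_coe.1 ((hμ i).trans (Real.le_coe_toNNReal a))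
  obtain ⟨m, -, hm⟩ :=
    (isCompact_setOfPred_finiteMeasure_le_of_compactSpace T a.toNNReal).ultrafilter_le_nhds'
      (l.map V) (show ∀ᶠ i in (l : Filter ι), (V i).mass ≤ a.toNNReal from .of_forall hV)
  have hlim (f : C(T, X)) : ∃ z, Tendsto (fun i => vint f (μ i)) l (𝓝 z) := by
    obtain ⟨z, -, hz⟩ := (isCompact_closedBall (0 : K) (‖f‖ * a)).ultrafilter_le_nhds'
      (l.map fun i => vint f (μ i))
      (show ∀ᶠ i in (l : Filter ι), vint f (μ i) ∈ Metric.closedBall (0 : K) (‖f‖ * a) from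
        .of_forall fun i => mem_closedBall_zero_iff.2 <|
          (norm_vint_le_of_bound f.norm_coe_le_norm (norm_nonneg _) _).trans
            (mul_le_mul_of_nonneg_left (hμ i) (norm_nonneg _)))
    exact ⟨z, hz⟩
  choose Φ hΦ using hlim
  have hint (f : C(T, X)) (i : ι) := integrable_of_continuous f.continuous
    (μ i : VectorMeasure T X).variation
  let Φ' : C(T, X) →ₗ[K] K :=
    { toFun := Φ
      map_add' := fun f g => tendsto_nhds_unique (hΦ (f + g)) <|
        ((hΦ f).add (hΦ g)).congr fun i => (vint_add (hint f i) (hint g i)).symm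
      map_smul' := fun c f => tendsto_nhds_unique (hΦ (c • f)) <|
        ((hΦ f).const_mul c).congr fun i => (vint_smul c f (μ i)).symm }
  obtain ⟨ν, hν⟩ := exists_vint_eq_of_dominated (m : Measure T) Φ' fun f => by
    have hnorm := FiniteMeasure.tendsto_iff_forall_integral_tendsto.1
      (show Tendsto V l (𝓝 m) from hm)
      (BoundedContinuousFunction.mkOfCompact ⟨_, f.continuous.norm⟩)
    exact le_of_tendsto_of_tendsto (hΦ f).norm hnorm (.of_forall fun i => norm_vint_le f (μ i))
  exact ⟨ν, fun f => (hν f).symm ▸ hΦ f⟩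

end WeakStarCompactness

/-! ### Fixed points -/

section FixedPoint

variable [NormedSpace ℝ X] [IsScalarTower ℝ K X] [CompactSpace T] [FiniteDimensional ℝ X]
  {M : ℕ} {ω : Fin M → T → T} {R : Fin M → X →L[K] X}

theorem varNorm_sub_le (μ ν : cabv K T X) : varNorm (μ - ν) ≤ varNorm μ + varNorm ν := by
  rw [varNorm, varNorm, varNorm, ← ENNReal.toReal_add μ.2.ne ν.2.ne]
  exact ENNReal.toReal_mono (ENNReal.add_ne_top.2 ⟨μ.2.ne, ν.2.ne⟩)
    (VectorMeasure.variation_sub_le (μ := (μ : VectorMeasure T X)) univ)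

theorem mkDist_iterate_le {r : Fin M → ℝ≥0} (hω : ∀ i, LipschitzWith (r i) (ω i))
    (μ₀ μ : cabv K T X) (k : ℕ) :
    mkDist ((markovOp₂ R ω μ₀)^[k + 1] μ) ((markovOp₂ R ω μ₀)^[k] μ) ≤
      (∑ i, ‖R i‖ * (1 + r i)) ^ k * mkDist (markovOp₂ R ω μ₀ μ) μ := by
  have := FiniteDimensional.complete ℝ X
  induction k with
  | zero => simp
  | succ k ih =>
    rw [Function.iterate_succ_apply'] at ih
    rw [Function.iterate_succ_apply', Function.iterate_succ_apply' _ k, pow_succ', mul_assoc]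
    exact (mkDist_markovOp₂_le hω μ₀ _ _).trans (mul_le_mul_of_nonneg_left ih (by positivity))

/-- Weak* limits, along an ultrafilter, of the iterates of `H₂` are fixed points: consecutive
iterates have Monge–Kantorovich distance tending to `0`, hence the same weak* limits, and `H₂` is
weak* continuous. -/
theorem exists_fixedPoint {r : Fin M → ℝ≥0} (hω : ∀ i, LipschitzWith (r i) (ω i))
    (hd : ∑ i, ‖R i‖ * (1 + r i) < 1) {μ₀ : cabv K T X} {a : ℝ} {A : Set (cabv K T X)}
    (hne : A.Nonempty) (hball : A ⊆ varBall K T X a) (hA : IsClosed[weakStar K T X] A)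
    (hmaps : ∀ μ ∈ A, markovOp₂ R ω μ₀ μ ∈ A) : ∃ μ ∈ A, markovOp₂ R ω μ₀ μ = μ := by
  have := FiniteDimensional.complete ℝ X
  obtain ⟨μ₁, hμ₁⟩ := hne
  set x : ℕ → cabv K T X := fun k => (markovOp₂ R ω μ₀)^[k] μ₁ with hx
  have hsucc (k : ℕ) : x (k + 1) = markovOp₂ R ω μ₀ (x k) := Function.iterate_succ_apply' ..
  have hxA (k : ℕ) : x k ∈ A := by
    induction k with
    | zero => exact hμ₁
    | succ k ih => exact hsucc k ▸ hmaps _ ih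
  obtain ⟨ν, hν⟩ := exists_tendsto_vint_ultrafilter (hyperfilter ℕ) fun k => hball (hxA k)
  refine ⟨ν, ?_, sub_eq_zero.1 (eq_zero_of_forall_vint_eq_zero fun f => ?_)⟩
  · let _ := weakStar K T X
    exact hA.mem_of_tendsto (tendsto_weakStar hν) (.of_forall hxA)
  have hcont (i : Fin M) : Continuous (ω i) := (hω i).continuous
  have hH (μ : cabv K T X) : vint f (markovOp₂ R ω μ₀ μ) =
      ∑ i, vint (fun t => ContinuousLinearMap.adjoint (R i) (f (ω i t))) μ + vint f μ₀ := by
    rw [markovOp₂, vint_add_measure f.continuous, vint_markovOp hcont f.continuous]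
  have hlim : Tendsto (fun k => vint f (x (k + 1))) (hyperfilter ℕ)
      (𝓝 (vint f (markovOp₂ R ω μ₀ ν))) := by
    simp_rw [hsucc, hH]
    exact (tendsto_finsetSum _ fun i _ => hν ⟨_, (ContinuousLinearMap.adjoint (R i)).continuous.comp
      (f.continuous.comp (hcont i))⟩).add_const _
  have hmk : Tendsto (fun k => mkNorm (x (k + 1) - x k)) atTop (𝓝 0) := by
    refine squeeze_zero (fun _ => mkNorm_nonneg _) (fun k => mkDist_iterate_le hω μ₀ μ₁ k) ?_
    simpa using (tendsto_pow_atTop_nhds_zero_of_lt_one (by positivity) hd).mul_const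
      (mkDist (markovOp₂ R ω μ₀ μ₁) μ₁)
  have hdiff : Tendsto (fun k => vint f (x (k + 1) - x k)) (hyperfilter ℕ) (𝓝 0) :=
    tendsto_vint_zero_of_tendsto_mkNorm
      (fun k => (varNorm_sub_le _ _).trans (add_le_add (hball (hxA _)) (hball (hxA k))))
      (hmk.mono_left Nat.hyperfilter_le_atTop) f
  rw [vint_sub_measure f.continuous]
  refine tendsto_nhds_unique ((hlim.sub (hν f)).congr fun k => ?_) hdiff
  rw [vint_sub_measure f.continuous]

/-- The contraction property of `H₂` makes the Monge–Kantorovich distance of two fixed points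
vanish. -/
theorem eq_of_fixedPoints {r : Fin M → ℝ≥0} (hω : ∀ i, LipschitzWith (r i) (ω i))
    (hd : ∑ i, ‖R i‖ * (1 + r i) < 1) {μ₀ μ ν : cabv K T X} (hμ : markovOp₂ R ω μ₀ μ = μ)
    (hν : markovOp₂ R ω μ₀ ν = ν) : μ = ν := by
  have := FiniteDimensional.complete ℝ X
  have h := mkDist_markovOp₂_le (R := R) hω μ₀ μ ν
  rw [hμ, hν, mkDist] at h
  have h0 := mkNorm_nonneg (μ - ν)
  exact sub_eq_zero.1 (eq_zero_of_mkNorm_eq_zero (by nlinarith))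

end FixedPoint

end FractalVM

open FractalVM in
theorem theorem2p2p2 {K : Type*} [RCLike K] {n : ℕ} (hn : 1 ≤ n)
    {T : Type*} [MetricSpace T] [CompactSpace T] [Nontrivial T]
    [MeasurableSpace T] [BorelSpace T]
    {M : ℕ} (hM : 1 ≤ M)
    (ω : Fin M → T → T) (hω : ∀ i, lipConst (ω i) < ∞)
    (R : Fin M → EuclideanSpace K (Fin n) →L[K] EuclideanSpace K (Fin n))
    (d : ℝ) (hd : d = ∑ i, ‖R i‖ * (1 + (lipConst (ω i)).toReal))
    (a : ℝ) (ha : 0 < a) (μ₀ : cabv K T (EuclideanSpace K (Fin n))) :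
    -- a sufficient condition for `d < 1`
    ((∀ i, lipConst (ω i) < 1) → ∑ i, ‖R i‖ ≤ 1 / 2 → d < 1) ∧
    -- a sufficient condition for the choice of the whole ball as `A`
    (varNorm μ₀ + a * ∑ i, ‖R i‖ ≤ a →
      (varBall K T (EuclideanSpace K (Fin n)) a).Nonempty ∧
      IsClosed[weakStar K T (EuclideanSpace K (Fin n))]
        (varBall K T (EuclideanSpace K (Fin n)) a) ∧
      ∀ μ ∈ varBall K T (EuclideanSpace K (Fin n)) a,
        markovOp₂ R ω μ₀ μ ∈ varBall K T (EuclideanSpace K (Fin n)) a) ∧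
    -- the main claim
    (d < 1 → ∀ A : Set (cabv K T (EuclideanSpace K (Fin n))),
      A.Nonempty → A ⊆ varBall K T (EuclideanSpace K (Fin n)) a →
      IsClosed[weakStar K T (EuclideanSpace K (Fin n))] A →
      (∀ μ ∈ A, markovOp₂ R ω μ₀ μ ∈ A) →
      (∀ μ ∈ A, ∀ ν ∈ A,
        mkDist (markovOp₂ R ω μ₀ μ) (markovOp₂ R ω μ₀ ν) ≤ d * mkDist μ ν) ∧
      (μ₀ = 0 → 0 ∈ A) ∧
      ∃ μs ∈ A, markovOp₂ R ω μ₀ μs = μs ∧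
        (∀ ν ∈ A, markovOp₂ R ω μ₀ ν = ν → ν = μs) ∧
        (μ₀ = 0 → μs = 0)) := by
  have hlip (i : Fin M) : LipschitzWith (lipConst (ω i)).toNNReal (ω i) :=
    lipschitzWith_iff_lipConst_le.2 (ENNReal.coe_toNNReal (hω i).ne).ge
  have hcont (i : Fin M) : Continuous (ω i) := (hlip i).continuous
  have hd' : d = ∑ i, ‖R i‖ * (1 + ((lipConst (ω i)).toNNReal : ℝ)) := hd
  refine ⟨fun hr hR => ?_, fun hR => ⟨⟨0, ?_⟩, isClosed_varBall ha.le, fun μ hμ => ?_⟩,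
    fun hd1 A hne hball hA hmaps => ?_⟩
  · have hr1 (i : Fin M) : (lipConst (ω i)).toReal < 1 := by
      simpa using (ENNReal.toReal_lt_toReal (hω i).ne ENNReal.one_ne_top).2 (hr i)
    rw [hd]
    by_cases h0 : ∀ i, ‖R i‖ = 0
    · simp [h0]
    · push Not at h0
      obtain ⟨j, hj⟩ := h0
      calc ∑ i, ‖R i‖ * (1 + (lipConst (ω i)).toReal) < ∑ i, ‖R i‖ * 2 := by
            refine Finset.sum_lt_sum (fun i _ => ?_) ⟨j, Finset.mem_univ j, ?_⟩
            · exact mul_le_mul_of_nonneg_left (by linarith [hr1 i]) (norm_nonneg _)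
            · exact mul_lt_mul_of_pos_left (by linarith [hr1 j])
                ((norm_nonneg _).lt_of_ne' hj)
        _ ≤ 1 := by
            rw [← Finset.sum_mul]
            linarith
  · change varNorm _ ≤ a
    rw [varNorm_eq_zero_iff.2 rfl]
    exact ha.le
  · have hμ' : varNorm μ ≤ a := hμ
    refine (varNorm_markovOp₂_le hcont μ₀ μ).trans ?_
    have : (∑ i, ‖R i‖) * varNorm μ ≤ (∑ i, ‖R i‖) * a :=
      mul_le_mul_of_nonneg_left hμ' (Finset.sum_nonneg fun _ _ => norm_nonneg _)
    linarith
  · have : FiniteDimensional ℝ (EuclideanSpace K (Fin n)) := FiniteDimensional.trans ℝ K _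
    rw [hd'] at hd1
    obtain ⟨μs, hμs, hfix⟩ := exists_fixedPoint hlip hd1 hne hball hA hmaps
    -- For `μ₀ = 0` the zero measure is a fixed point, so that it is the one found in `A`.
    have hzero (h : μ₀ = 0) : μs = 0 :=
      eq_of_fixedPoints hlip hd1 hfix (by rw [h, markovOp₂, markovOp_zero hcont, add_zero])
    exact ⟨fun μ _ ν _ => hd' ▸ mkDist_markovOp₂_le hlip μ₀ μ ν, fun h => hzero h ▸ hμs,
      μs, hμs, hfix, fun ν _ hν => eq_of_fixedPoints hlip hd1 hν hfix, hzero⟩
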